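/- Let $\mathcal V$ be a variety of (non-empty) algebras in a language with finitely many operation symbols. Suppose that $\mathcal V$ is locally finite (every finitely generated member of $\mathcal V$ is finite) and congruence meet-semidistributive (the congruence lattice of every member of $\mathcal V$ satisfies $x\wedge y = x\wedge z \Rightarrow x\wedge y = x\wedge(y\vee z)$). Let $M$ be the maximum of the arities of the operation symbols of the language ($M=0$ if there are none), and let $M'=\max(M,3)$. For $n\ge 1$ let $f_{\mathcal V}(n)$ denote the cardinality of the $\mathcal V$-free algebra on $n$ generators. Let $m\ge 2$ be an integer. If $\mathcal V$ has a subdirectly irreducible member (finite or infinite) of cardinality greater than $m$, then $\mathcal V$ has a finite subdirectly irreducible member $B$ such that $$m < |B| \le f_{\mathcal V}\bigl(2^{m^2+7m}\cdot M'\bigr).$$ -/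

import Mathlib

/-!
Universal algebra over a language of operation symbols.  An algebra of type `L` is a structure for
a first-order language `L` without relation symbols (`L.IsAlgebraic`); homomorphisms, subalgebras
and terms are the ones of Mathlib.
-/

universe u v w x

namespace UniversalAlgebra

open FirstOrder FirstOrder.Language

section Congruences

variable (L : FirstOrder.Language.{u, v}) (A : Type w) [L.Structure A]

/-- A congruence of an algebra: an equivalence relation preserved by all fundamental operations. -/
structure Congruence extends Setoid A where
  compat : ∀ {n : ℕ} (f : L.Functions n) (a b : Fin n → A),
    (∀ i, toSetoid (a i) (b i)) → toSetoid (Structure.funMap f a) (Structure.funMap f b)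

namespace Congruence

variable {L A}

theorem toSetoid_injective :
    Function.Injective (Congruence.toSetoid : Congruence L A → Setoid A) :=
  fun θ η h => by cases θ; cases η; cases h; rfl

/-- Congruences are ordered by inclusion. -/
instance : PartialOrder (Congruence L A) :=
  PartialOrder.lift Congruence.toSetoid toSetoid_injective

/-- The infimum of a set of congruences is its intersection. -/
instance : InfSet (Congruence L A) where
  sInf S :=
    { r := fun a b => ∀ θ ∈ S, θ.toSetoid a b
      iseqv :=
        { refl := fun a θ _ => θ.toSetoid.refl a
          symm := fun h θ hθ => θ.toSetoid.symm (h θ hθ)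
          trans := fun h h' θ hθ => θ.toSetoid.trans (h θ hθ) (h' θ hθ) }
      compat := fun f a b h θ hθ => θ.compat f a b fun i => h i θ hθ }

theorem isGLB_sInf (S : Set (Congruence L A)) : IsGLB S (sInf S) :=
  ⟨fun θ hθ _ _ h => h θ hθ, fun _ hθ _ _ h _ hη => hθ hη h⟩

/-- The congruence lattice `Con A`. Meets are intersections, the join of two congruences is the
least congruence containing both, and `⊥` is the equality relation. -/
instance : CompleteLattice (Congruence L A) :=
  completeLatticeOfInf _ isGLB_sInf

/-- The quotient algebra of `A` by a congruence. -/
@[reducible]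
noncomputable def quotientStructure [L.IsAlgebraic] (θ : Congruence L A) :
    L.Structure (Quotient θ.toSetoid) where
  funMap f a := Quotient.mk θ.toSetoid (Structure.funMap f fun i => (a i).out)
  RelMap r := isEmptyElim r

end Congruence

/-- `A` is subdirectly irreducible: among its congruences other than the equality relation there is
a least one (the monolith). In particular `A` has at least two elements. -/
def IsSubdirectlyIrreducible : Prop :=
  ∃ μ : Congruence L A, μ ≠ ⊥ ∧ ∀ θ : Congruence L A, θ ≠ ⊥ → μ ≤ θ

end Congruences

/-- The meet-semidistributive law for lattices. -/
def IsMeetSemidistributive (P : Type*) [Lattice P] : Prop :=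
  ∀ a b c : P, a ⊓ b = a ⊓ c → a ⊓ b = a ⊓ (b ⊔ c)

section Varieties

variable (L : FirstOrder.Language.{u, v}) [L.IsAlgebraic]

/-- The product of a family of algebras, with coordinatewise operations. -/
instance piStructure {ι : Type x} (A : ι → Type w) [∀ i, L.Structure (A i)] :
    L.Structure (∀ i, A i) where
  funMap f a := fun i => Structure.funMap f fun j => a j i
  RelMap r := isEmptyElim r

/-- The maximum of the arities of the operation symbols of `L`, for a language with finitely many
symbols (`0` if there are no symbols). -/
noncomputable def maxArity : ℕ :=
  sSup {n : ℕ | Nonempty (L.Functions n)}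

/-- A variety: a class of (non-empty) algebras of type `L` closed under homomorphic images,
subalgebras and products. Closure under isomorphic copies is part of `image`, and the empty product
puts the one-element algebras into every variety. -/
structure Variety where
  Mem : (A : Type w) → [L.Structure A] → Prop
  nonempty : ∀ (A : Type w) [L.Structure A], Mem A → Nonempty A
  image : ∀ (A B : Type w) [L.Structure A] [L.Structure B] (φ : A →[L] B),
    Function.Surjective φ → Mem A → Mem B
  subalgebra : ∀ (A : Type w) [L.Structure A] (S : L.Substructure A),
    Nonempty S → Mem A → Mem S
  product : ∀ (ι : Type w) (A : ι → Type w) [∀ i, L.Structure (A i)],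
    (∀ i, Mem (A i)) → Mem (∀ i, A i)

namespace Variety

variable {L} (V : Variety.{u, v, w} L)

/-- `V` is congruence meet-semidistributive if the congruence lattice of each member is
meet-semidistributive. -/
def IsCongruenceMeetSemidistributive : Prop :=
  ∀ (A : Type w) [L.Structure A], V.Mem A → IsMeetSemidistributive (Congruence L A)

/-- `V` is locally finite if each finitely generated member is finite. -/
def IsLocallyFinite : Prop :=
  ∀ (A : Type w) [L.Structure A], V.Mem A → Structure.FG L A → Finite A

/-- The identity `s ≈ t` is true in all members of `V`. -/
def Satisfies {α : Type x} (s t : L.Term α) : Prop :=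
  ∀ (A : Type w) [L.Structure A], V.Mem A → ∀ a : α → A, s.realize a = t.realize a

end Variety

/-- The algebra of all terms in the variables `α`. -/
instance termStructure (α : Type x) : L.Structure (L.Term α) where
  funMap f ts := Term.func f ts
  RelMap r := isEmptyElim r

namespace Variety

variable {L} (V : Variety.{u, v, w} L)

/-- The congruence on the term algebra that consists of the identities of `V`. -/
def freeCongruence (α : Type x) : Congruence L (L.Term α) where
  r s t := V.Satisfies s t
  iseqv :=
    { refl := fun _ _ _ _ _ => rfl
      symm := fun h A _ hA a => (h A hA a).symm
      trans := fun h h' A _ hA a => (h A hA a).trans (h' A hA a) }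
  compat f _ _ h := fun A _ hA a =>
    congrArg (Structure.funMap f) (funext fun i => h i A hA a)

/-- The `V`-free algebra over the set `α` of free generators: terms modulo the identities of `V`. -/
def Free (α : Type x) : Type (max u x) :=
  Quotient (V.freeCongruence α).toSetoid

noncomputable instance (α : Type x) : L.Structure (V.Free α) :=
  (V.freeCongruence α).quotientStructure

/-- The free spectrum of `V`: the cardinality of the `V`-free algebra on `n` generators (`⊤` if that
algebra is infinite). -/
noncomputable def freeSpectrum (n : ℕ) : ℕ∞ :=
  ENat.card (V.Free (Fin n))

end Variety

end Varieties

end UniversalAlgebra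

/-! Let `A` be subdirectly irreducible with more than `m` elements, and suppose that every
subalgebra on at most `N` generators has only subdirectly irreducible quotients of size at most `m`.
The aim is a contradiction; the algebra sought is then a large subdirectly irreducible quotient of
an `N`-generated subalgebra, which local finiteness makes finite and the free algebra bounds.

In a finite meet-semidistributive lattice an atom `j` has a pseudocomplement `θ`, and every element
not below `θ` is above `j` (`exists_prime`). In `Con S` this makes `S/θ` subdirectly irreducible, so
`θ` has at most `m` classes when `S` is small. A transversal of `θ` together with one pair of `j`
then suffices to witness that two principal congruences meet, so such a witness shrinks to `m + 6`
generators (`Meets.exists_small`).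

If a nontrivial pair had no small witness of meeting a monolith pair `(c, d)`, then the pairs
without one would generate a congruence containing `(c, d)`. Willard terms exclude this: some link
of a chain from `c` to `d` changes the truth of an equation and thereby has a witness
(`exists_small_meets`).

Iterating over all pairs from `m + 1` elements gives one nontrivial pair below all their principal
congruences in a small `S`. An atom below that pair yields a `θ` separating all `m + 1` elements, a
contradiction. -/

namespace UniversalAlgebra

open FirstOrder FirstOrder.Language

namespace Congruence

/-! ### Principal congruences, pullbacks and unary translations. -/

section Basic

variable {L : FirstOrder.Language.{u, v}} {A : Type w} [L.Structure A]

/-- The principal congruence generated by a pair. -/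
def cg (a b : A) : Congruence L A := sInf {θ | θ.toSetoid a b}

theorem cg_rel (a b : A) : (cg (L := L) a b).toSetoid a b := fun _ h => h

theorem cg_le_iff {a b : A} {θ : Congruence L A} : cg a b ≤ θ ↔ θ.toSetoid a b :=
  ⟨fun h => h (cg_rel a b), fun h => sInf_le h⟩

theorem inf_rel {θ η : Congruence L A} {a b : A} :
    (θ ⊓ η).toSetoid a b ↔ θ.toSetoid a b ∧ η.toSetoid a b := by
  simp only [← cg_le_iff, le_inf_iff]

/-- The equality relation as a congruence. -/
def equality (L : FirstOrder.Language.{u, v}) (A : Type w) [L.Structure A] : Congruence L A where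
  r a b := a = b
  iseqv := ⟨fun _ => rfl, Eq.symm, Eq.trans⟩
  compat f _ _ h := congrArg (Structure.funMap f) (funext h)

theorem bot_rel {a b : A} : (⊥ : Congruence L A).toSetoid a b ↔ a = b :=
  ⟨fun h => (bot_le : ⊥ ≤ equality L A) h, fun h => h ▸ (⊥ : Congruence L A).toSetoid.refl a⟩

theorem ne_bot_iff {θ : Congruence L A} : θ ≠ ⊥ ↔ ∃ a b, θ.toSetoid a b ∧ a ≠ b := by
  constructor
  · intro h
    by_contra! hc
    exact h (le_bot_iff.1 fun a b hab => bot_rel.2 (hc a b hab))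
  · rintro ⟨a, b, hab, hne⟩ rfl
    exact hne (bot_rel.1 hab)

theorem eq_of_inf_eq_bot {θ η : Congruence L A} (h : θ ⊓ η = ⊥) {a b : A}
    (hθ : θ.toSetoid a b) (hη : η.toSetoid a b) : a = b :=
  bot_rel.1 (h ▸ inf_rel.2 ⟨hθ, hη⟩)

theorem cg_ne_bot {a b : A} (h : a ≠ b) : cg (L := L) a b ≠ ⊥ :=
  ne_bot_iff.2 ⟨a, b, cg_rel a b, h⟩

theorem exists_not_rel_of_not_le {θ η : Congruence L A} (h : ¬ θ ≤ η) :
    ∃ a b, θ.toSetoid a b ∧ ¬ η.toSetoid a b := by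
  by_contra! hc
  exact h fun a b hab => hc a b hab

/-- An equivalence relation preserved by changing one argument at a time is a congruence. -/
def ofUnary (s : Setoid A)
    (h : ∀ {n : ℕ} (f : L.Functions n) (e : Fin n → A) (i : Fin n) (a b : A), s a b →
      s (Structure.funMap f (Function.update e i a)) (Structure.funMap f (Function.update e i b))) :
    Congruence L A where
  toSetoid := s
  compat {n} f a b hab := by
    classical
    have key : ∀ t : Finset (Fin n),
        s (Structure.funMap f a) (Structure.funMap f (t.piecewise b a)) := by
      intro t
      induction t using Finset.induction_on with
      | empty => simp
      | insert j t hj ih =>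
        refine s.trans ih ?_
        have h1 := h f (t.piecewise b a) j (a j) (b j) (hab j)
        rw [Finset.piecewise_insert]
        have h2 : Function.update (t.piecewise b a) j (a j) = t.piecewise b a := by
          conv_rhs => rw [← Function.update_eq_self j (t.piecewise b a)]
          rw [Finset.piecewise_eq_of_notMem _ _ _ hj]
        rwa [h2] at h1
    simpa using key Finset.univ

instance [Finite A] : Finite (Congruence L A) :=
  Finite.of_injective (fun θ : Congruence L A => {p : A × A | θ.toSetoid p.1 p.2}) fun _ _ h =>
    le_antisymm (fun a b hab => (Set.ext_iff.1 h (a, b)).1 hab)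
      (fun a b hab => (Set.ext_iff.1 h (a, b)).2 hab)

variable {B : Type x} [L.Structure B]

/-- The preimage of a congruence under a homomorphism. -/
def comap (φ : A →[L] B) (θ : Congruence L B) : Congruence L A where
  toSetoid := θ.toSetoid.comap φ
  compat f a b h := by
    change θ.toSetoid (φ _) (φ _)
    rw [φ.map_fun, φ.map_fun]
    exact θ.compat f _ _ h

theorem cg_map (φ : A →[L] B) {a b c d : A} (h : (cg (L := L) a b).toSetoid c d) :
    (cg (L := L) (φ a) (φ b)).toSetoid (φ c) (φ d) :=
  cg_le_iff.2 (show (comap φ (cg (φ a) (φ b))).toSetoid a b from cg_rel (φ a) (φ b)) h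

theorem realize_rel (θ : Congruence L A) {α : Type*} (t : L.Term α) {p q : α → A}
    (h : ∀ i, θ.toSetoid (p i) (q i)) : θ.toSetoid (t.realize p) (t.realize q) := by
  induction t with
  | var i => exact h i
  | func f ts ih => exact θ.compat f _ _ ih

end Basic

/-! ### Subdirectly irreducible quotients. -/

section Quotient

variable {L : FirstOrder.Language.{u, v}} [L.IsAlgebraic] {A : Type w} [L.Structure A]

/-- The canonical homomorphism onto a quotient algebra. -/
def mkHom (θ : Congruence L A) :
    letI := θ.quotientStructure
    A →[L] Quotient θ.toSetoid :=
  letI := θ.quotientStructure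
  { toFun := Quotient.mk θ.toSetoid
    map_fun' := fun f a => Quotient.sound
      (θ.compat f _ _ fun i => θ.toSetoid.symm (Quotient.mk_out (s := θ.toSetoid) (a i)))
    map_rel' := fun r => isEmptyElim r }

/-- If `θ` has a congruence `j` not below it that is contained in every congruence not below `θ`,
then the quotient by `θ` is subdirectly irreducible. -/
theorem isSubdirectlyIrreducible_quotient (θ j : Congruence L A) (hj : ¬ j ≤ θ)
    (h : ∀ ψ : Congruence L A, ¬ ψ ≤ θ → j ≤ ψ) :
    letI := θ.quotientStructure
    IsSubdirectlyIrreducible L (Quotient θ.toSetoid) := by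
  let := θ.quotientStructure
  obtain ⟨c, d, hcd, hn⟩ := exists_not_rel_of_not_le hj
  have hmk : ∀ a, θ.mkHom a = Quotient.mk θ.toSetoid a := fun _ => rfl
  have key : ∀ ψ : Congruence L (Quotient θ.toSetoid), ψ ≠ ⊥ →
      ψ.toSetoid (θ.mkHom c) (θ.mkHom d) := by
    intro ψ hψ
    obtain ⟨p, q, hpq, hne⟩ := ne_bot_iff.1 hψ
    induction p using Quotient.inductionOn with | _ a
    induction q using Quotient.inductionOn with | _ b
    -- A nontrivial congruence of the quotient pulls back to one not below `θ`, hence above `j`.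
    exact h (comap θ.mkHom ψ) (fun hle => hne (Quotient.sound (hle hpq))) hcd
  refine ⟨cg (θ.mkHom c) (θ.mkHom d), cg_ne_bot fun hc => hn (Quotient.exact hc), fun ψ hψ => ?_⟩
  exact cg_le_iff.2 (key ψ hψ)

end Quotient

end Congruence

/-! ### Atoms in meet-semidistributive lattices. -/

section Lattice

/-- In a finite meet-semidistributive lattice every atom has a pseudocomplement, which behaves as a
prime element. -/
theorem IsMeetSemidistributive.exists_prime {P : Type*} [Lattice P] [OrderBot P] [Finite P]
    (hP : IsMeetSemidistributive P) {c : P} (hc : c ≠ ⊥) :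
    ∃ j θ : P, j ≤ c ∧ j ≠ ⊥ ∧ j ⊓ θ = ⊥ ∧ ∀ x, ¬ x ≤ θ → j ≤ x := by
  obtain ⟨j, hj, hjc⟩ := (eq_bot_or_exists_atom_le c).resolve_left hc
  obtain ⟨θ, hθ⟩ := (Set.toFinite {x : P | j ⊓ x = ⊥}).exists_maximal ⟨⊥, inf_bot_eq j⟩
  refine ⟨j, θ, hjc, hj.1, hθ.prop, fun x hx => ?_⟩
  by_contra hjx
  have h0 : j ⊓ x = ⊥ := hj.2 _ (inf_lt_left.2 hjx)
  -- Semidistributivity gives `j ⊓ (θ ⊔ x) = ⊥`, against the maximality of `θ`.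
  have h1 := hP j θ x (hθ.prop.trans h0.symm)
  have h2 : θ ⊔ x ≤ θ := hθ.le_of_ge (h1.symm.trans hθ.prop) le_sup_left
  exact hx (le_sup_right.trans h2)

end Lattice

namespace Congruence

/-! ### Passing from an algebra to a subalgebra that meets every class of `θ`. -/

section Transfer

variable {L : FirstOrder.Language.{u, v}} {T : Type w} {S : Type x} [L.Structure T] [L.Structure S]

/-- The image of a congruence under a homomorphism that is surjective modulo `θ`. -/
def mapMod (φ : T →[L] S) (θ : Congruence L S) (hφ : ∀ s, ∃ t, θ.toSetoid s (φ t))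
    (χ : Congruence L T) (hχ : comap φ θ ≤ χ) : Congruence L S where
  r a b := ∃ s t, θ.toSetoid a (φ s) ∧ θ.toSetoid b (φ t) ∧ χ.toSetoid s t
  iseqv :=
    { refl := fun a => by
        obtain ⟨t, ht⟩ := hφ a
        exact ⟨t, t, ht, ht, χ.toSetoid.refl t⟩
      symm := fun ⟨s, t, hs, ht, h⟩ => ⟨t, s, ht, hs, χ.toSetoid.symm h⟩
      trans := fun ⟨s, t, hs, ht, h⟩ ⟨s', t', hs', ht', h'⟩ =>
        ⟨s, t', hs, ht', χ.toSetoid.trans h (χ.toSetoid.trans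
          (hχ (show θ.toSetoid (φ t) (φ s') from θ.toSetoid.trans (θ.toSetoid.symm ht) hs')) h')⟩ }
  compat f a b h := by
    choose s t hs ht hst using h
    refine ⟨Structure.funMap f s, Structure.funMap f t, ?_, ?_, χ.compat f _ _ hst⟩
    · rw [φ.map_fun]; exact θ.compat f _ _ hs
    · rw [φ.map_fun]; exact θ.compat f _ _ ht

variable {φ : T →[L] S} {θ j : Congruence L S}

/-- If the meet were trivial, then semidistributivity in `Con T` would make `cg c d` disjoint from
`χ`, the join of `cg a b` with the restriction of `θ`. But the image of `χ` in `S` is not below `θ`,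
so it contains `j` and puts `(c, d)` into `χ`. -/
theorem cg_inf_cg_ne_bot (hT : IsMeetSemidistributive (Congruence L T))
    (hinj : Function.Injective φ) (hφ : ∀ s, ∃ t, θ.toSetoid s (φ t)) (hjθ : j ⊓ θ = ⊥)
    (hprime : ∀ ψ : Congruence L S, ¬ ψ ≤ θ → j ≤ ψ) {a b c d : T}
    (hab : ¬ θ.toSetoid (φ a) (φ b)) (hcd : j.toSetoid (φ c) (φ d)) (hne : c ≠ d) :
    cg (L := L) a b ⊓ cg c d ≠ ⊥ := by
  intro h0
  have h1 : cg c d ⊓ comap φ θ = ⊥ := by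
    by_contra hc
    obtain ⟨p, q, hpq, hn⟩ := ne_bot_iff.1 hc
    obtain ⟨h1, h2⟩ := inf_rel.1 hpq
    exact hn (hinj (eq_of_inf_eq_bot hjθ
      (cg_le_iff.2 (show (comap φ j).toSetoid c d from hcd) h1) h2))
  have h2 := hT (cg c d) (comap φ θ) (cg a b) (h1.trans (by rw [inf_comm, h0]))
  set χ := comap φ θ ⊔ cg (L := L) a b
  have hle : comap φ θ ≤ χ := le_sup_left
  have habχ : χ.toSetoid a b := (le_sup_right : cg a b ≤ χ) (cg_rel a b)
  have h3 : j ≤ mapMod φ θ hφ χ hle := hprime _ fun hc =>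
    hab (hc (⟨a, b, θ.toSetoid.refl _, θ.toSetoid.refl _, habχ⟩))
  obtain ⟨s, t, hs, ht, hst⟩ := h3 hcd
  have hcdχ : χ.toSetoid c d := χ.toSetoid.trans (hle hs)
    (χ.toSetoid.trans hst (χ.toSetoid.symm (hle ht)))
  exact hne (eq_of_inf_eq_bot (h2.symm.trans h1) (cg_rel c d) hcdχ)

/-- Two pairs separated by `θ` generate principal congruences with nontrivial intersection, already
in a subalgebra that contains representatives modulo `θ` and a pair of `j`. -/
theorem cg_inf_cg_ne_bot_of_not_rel (hT : IsMeetSemidistributive (Congruence L T))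
    (hinj : Function.Injective φ) (hφ : ∀ s, ∃ t, θ.toSetoid s (φ t)) (hjθ : j ⊓ θ = ⊥)
    (hprime : ∀ ψ : Congruence L S, ¬ ψ ≤ θ → j ≤ ψ) {a b c d p q : T}
    (hab : ¬ θ.toSetoid (φ a) (φ b)) (hcd : ¬ θ.toSetoid (φ c) (φ d))
    (hpq : j.toSetoid (φ p) (φ q)) (hne : p ≠ q) :
    cg (L := L) a b ⊓ cg c d ≠ ⊥ := by
  -- The pair found below `cg a b` lies in `j` again, so it can replace `(p, q)` in a second
  -- application, to `(c, d)`.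
  obtain ⟨u, v, huv, hn⟩ := ne_bot_iff.1 (cg_inf_cg_ne_bot hT hinj hφ hjθ hprime hab hpq hne)
  obtain ⟨h1, h2⟩ := inf_rel.1 huv
  have h3 : j.toSetoid (φ u) (φ v) :=
    cg_le_iff.2 (show (comap φ j).toSetoid p q from hpq) h2
  obtain ⟨u', v', huv', hn'⟩ :=
    ne_bot_iff.1 (cg_inf_cg_ne_bot hT hinj hφ hjθ hprime hcd h3 hn)
  obtain ⟨h4, h5⟩ := inf_rel.1 huv'
  exact ne_bot_iff.2 ⟨u', v', inf_rel.2 ⟨cg_le_iff.2 h1 h5, h4⟩, hn'⟩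

end Transfer

end Congruence

/-! ### Willard terms and the free spectrum. -/

section Terms

variable {L : FirstOrder.Language.{u, v}} {A : Type w} [L.Structure A]

theorem mem_closure_range_iff {ι : Type*} {g : ι → A} {a : A} :
    a ∈ Substructure.closure L (Set.range g) ↔ ∃ t : L.Term ι, t.realize g = a := by
  rw [Substructure.mem_closure_iff_exists_term]
  constructor
  · rintro ⟨t, rfl⟩
    refine ⟨t.relabel fun y => y.2.choose, ?_⟩
    rw [Term.realize_relabel]
    congr 1
    funext y
    exact y.2.choose_spec
  · rintro ⟨t, rfl⟩
    refine ⟨t.relabel fun i => ⟨g i, i, rfl⟩, ?_⟩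
    rw [Term.realize_relabel]
    rfl

variable [L.IsAlgebraic]

/-- Evaluation at a coordinate is a homomorphism. -/
def evalHom {ι : Type x} (i : ι) : (ι → A) →[L] A where
  toFun a := a i
  map_rel' r := isEmptyElim r

namespace Variety

variable {V : Variety.{u, v, w} L}

theorem mem_quotient (hA : V.Mem A) (θ : Congruence L A) :
    letI := θ.quotientStructure
    V.Mem (Quotient θ.toSetoid) :=
  letI := θ.quotientStructure
  V.image A _ θ.mkHom Quotient.mk_surjective hA

/-- Willard's characterization of congruence meet-semidistributivity, for one pair of elements. -/
theorem IsCongruenceMeetSemidistributive.exists_terms (hsd : V.IsCongruenceMeetSemidistributive)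
    (hA : V.Mem A) {a b : A} (hab : a ≠ b) :
    ∃ s t : L.Term (Fin 3),
      (∀ p q : A, s.realize ![p, q, p] = t.realize ![p, q, p]) ∧
      ¬ (s.realize ![a, a, b] = t.realize ![a, a, b] ↔
        s.realize ![a, b, b] = t.realize ![a, b, b]) := by
  by_contra hc
  push Not at hc
  let g : Fin 3 → ((Fin 3 → A) → A) := fun i v => v i
  -- The three projections generate a concrete algebra of ternary term operations. Without the
  -- desired terms, `α` has equal meets with the kernels of evaluation at `(a, a, b)` and `(a, b,
  -- b)`. The first and third projections are `α`-related and joined through the second, so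
  -- semidistributivity forces `a = b`.
  let F := Substructure.closure L (Set.range g)
  have hg : ∀ i, g i ∈ F := fun i => Substructure.subset_closure ⟨i, rfl⟩
  have hF : V.Mem F := V.subalgebra _ F ⟨⟨g 0, hg 0⟩⟩ (V.product _ _ fun _ => hA)
  let ev : (Fin 3 → A) → (F →[L] A) := fun v => (evalHom v).comp F.subtype.toHom
  have hev : ∀ v (y : F), ev v y = y.1 v := fun _ _ => rfl
  let K : (Fin 3 → A) → Congruence L F := fun v =>
    Congruence.comap (ev v) (Congruence.equality L A)
  have hK : ∀ v (y z : F), (K v).toSetoid y z ↔ y.1 v = z.1 v := fun _ _ _ => Iff.rfl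
  let α : Congruence L F := sInf (Set.range fun p : A × A => K ![p.1, p.2, p.1])
  have hα : ∀ y z : F, α.toSetoid y z ↔ ∀ p q : A, y.1 ![p, q, p] = z.1 ![p, q, p] :=
    fun y z => ⟨fun h p q => h _ ⟨(p, q), rfl⟩, by rintro h _ ⟨p, rfl⟩; exact h p.1 p.2⟩
  have hterm : ∀ y : F, ∃ t : L.Term (Fin 3), ∀ v, y.1 v = t.realize v := by
    rintro ⟨y, hy⟩
    obtain ⟨t, rfl⟩ := mem_closure_range_iff.1 hy
    exact ⟨t, fun v => (HomClass.realize_term (evalHom (L := L) (A := A) v) (t := t) (v := g)).symm⟩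
  have key : ∀ y z : F, α.toSetoid y z →
      ((K ![a, a, b]).toSetoid y z ↔ (K ![a, b, b]).toSetoid y z) := by
    intro y z hyz
    obtain ⟨s, hs⟩ := hterm y
    obtain ⟨t, ht⟩ := hterm z
    have := hc s t fun p q => by rw [← hs, ← ht]; exact (hα y z).1 hyz p q
    rw [hK, hK, hs, hs, ht, ht]
    exact this
  have h0 : α ⊓ K ![a, a, b] = α ⊓ K ![a, b, b] := by
    apply le_antisymm
    · exact fun y z h => Congruence.inf_rel.2
        ⟨(Congruence.inf_rel.1 h).1, (key y z (Congruence.inf_rel.1 h).1).1 (Congruence.inf_rel.1 h).2⟩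
    · exact fun y z h => Congruence.inf_rel.2
        ⟨(Congruence.inf_rel.1 h).1, (key y z (Congruence.inf_rel.1 h).1).2 (Congruence.inf_rel.1 h).2⟩
  have h1 := hsd F hF _ _ _ h0
  have h2 : (α ⊓ (K ![a, a, b] ⊔ K ![a, b, b])).toSetoid ⟨g 0, hg 0⟩ ⟨g 2, hg 2⟩ := by
    refine Congruence.inf_rel.2 ⟨(hα _ _).2 fun p q => rfl, ?_⟩
    refine Setoid.trans' _ (y := ⟨g 1, hg 1⟩)
      ((le_sup_left : K ![a, a, b] ≤ K ![a, a, b] ⊔ K ![a, b, b]) ?_)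
      ((le_sup_right : K ![a, b, b] ≤ K ![a, a, b] ⊔ K ![a, b, b]) ?_)
    · exact (hK _ _ _).2 rfl
    · exact (hK _ _ _).2 rfl
  rw [← h1] at h2
  exact hab ((hK _ _ _).1 (Congruence.inf_rel.1 h2).2)

theorem card_closure_le_freeSpectrum (hA : V.Mem A) {n : ℕ} {E : Finset A}
    (hE : E.Nonempty) (hn : E.card ≤ n) :
    ENat.card (Substructure.closure L (E : Set A)) ≤ V.freeSpectrum n := by
  have : Nonempty E := hE.to_subtype
  obtain ⟨e, he⟩ : ∃ e : Fin n → E, Function.Surjective e :=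
    -- Surplus generators repeat an element of `E`, which is why `E` must be nonempty.
    ⟨_, (Function.invFun_surjective (f := fun y : E => Fin.castLE hn (E.equivFin y))
      ((Fin.castLE_injective hn).comp E.equivFin.injective))⟩
  let g : Fin n → A := fun i => e i
  have hg : Set.range g = (E : Set A) := by
    ext y
    constructor
    · rintro ⟨i, rfl⟩; exact (e i).2
    · intro hy
      obtain ⟨i, hi⟩ := he ⟨y, hy⟩
      exact ⟨i, congrArg Subtype.val hi⟩
  rw [← hg]
  let F : V.Free (Fin n) → Substructure.closure L (Set.range g) :=
    Quotient.lift (s := (V.freeCongruence (Fin n)).toSetoid)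
      (fun t => ⟨t.realize g, mem_closure_range_iff.2 ⟨t, rfl⟩⟩)
      (fun s t hst => Subtype.ext (hst A hA g))
  have hF : Function.Surjective F := by
    rintro ⟨y, hy⟩
    obtain ⟨t, rfl⟩ := mem_closure_range_iff.1 hy
    exact ⟨Quotient.mk _ t, rfl⟩
  exact ENat.card_le_card_of_injective (Function.injective_surjInv hF)

end Variety

end Terms

/-! ### Witnesses of meeting and how to shrink them. -/

section Meeting

variable {L : FirstOrder.Language.{u, v}} {A : Type w} [L.Structure A]

/-- The principal congruences of the subalgebra `T` generated by `(x, y)` and `(c, d)` have a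
nontrivial intersection. -/
def Meets (T : L.Substructure A) (x y c d : A) : Prop :=
  ∃ (hx : x ∈ T) (hy : y ∈ T) (hc : c ∈ T) (hd : d ∈ T),
    Congruence.cg (L := L) (⟨x, hx⟩ : T) ⟨y, hy⟩ ⊓ Congruence.cg ⟨c, hc⟩ ⟨d, hd⟩ ≠ ⊥

/-- The quotients of the subalgebra `S` that are subdirectly irreducible have at most `m`
elements. -/
def IsResiduallyLE [L.IsAlgebraic] (m : ℕ) (S : L.Substructure A) : Prop :=
  ∀ θ : Congruence L S, @IsSubdirectlyIrreducible L (Quotient θ.toSetoid) θ.quotientStructure →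
    Nat.card (Quotient θ.toSetoid) ≤ m

/-- Witnesses persist in larger subalgebras, and pass from a pair to any pair generating it. -/
theorem Meets.of_rel {S T : L.Substructure A} (hST : S ≤ T) {x y x' y' c d : A} (hx : x ∈ T)
    (hy : y ∈ T) (h : Meets S x' y' c d)
    (hrel : ∀ (hx' : x' ∈ T) (hy' : y' ∈ T),
      (Congruence.cg (L := L) (⟨x, hx⟩ : T) ⟨y, hy⟩).toSetoid ⟨x', hx'⟩ ⟨y', hy'⟩) :
    Meets T x y c d := by
  obtain ⟨hx', hy', hc, hd, h⟩ := h
  refine ⟨hx, hy, hST hc, hST hd, ?_⟩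
  obtain ⟨a, b, hab, hne⟩ := Congruence.ne_bot_iff.1 h
  obtain ⟨h1, h2⟩ := Congruence.inf_rel.1 hab
  let φ := (Substructure.inclusion hST).toHom
  have hinj : Function.Injective φ := (Substructure.inclusion hST).injective
  refine Congruence.ne_bot_iff.2 ⟨φ a, φ b, Congruence.inf_rel.2
    ⟨?_, Congruence.cg_map φ h2⟩, fun h => hne (hinj h)⟩
  exact Congruence.cg_le_iff.2 (hrel (hST hx') (hST hy')) (Congruence.cg_map φ h1)

variable [L.IsAlgebraic] {V : Variety.{u, v, w} L}

theorem Variety.finite_of_fg (hfin : V.IsLocallyFinite) (hA : V.Mem A) {S : L.Substructure A}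
    (hS : S.FG) (hne : Nonempty S) : Finite S :=
  hfin S (V.subalgebra A S hne hA) ((Substructure.fg_iff_structure_fg S).1 hS)

theorem Meets.exists_small (hfin : V.IsLocallyFinite)
    (hsd : V.IsCongruenceMeetSemidistributive) (hA : V.Mem A) {m : ℕ} {S : L.Substructure A}
    (hS : S.FG) (hres : IsResiduallyLE m S) {x y c d : A} (h : Meets S x y c d) :
    ∃ E : Finset A, E.card ≤ m + 6 ∧ Meets (Substructure.closure L (E : Set A)) x y c d := by
  classical
  obtain ⟨hx, hy, hc, hd, h⟩ := h
  have hne : Nonempty S := ⟨⟨x, hx⟩⟩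
  have hfinS : Finite S := Variety.finite_of_fg hfin hA hS hne
  have hSV : V.Mem S := V.subalgebra A S hne hA
  obtain ⟨j, θ, hjle, hj, hjθ, hprime⟩ := (hsd S hSV).exists_prime h
  obtain ⟨p, q, hpq, hpqne⟩ := Congruence.ne_bot_iff.1 hj
  have hjnle : ¬ j ≤ θ := fun hle => hj (by rw [← hjθ, inf_eq_left.2 hle])
  have hsep : ∀ ψ : Congruence L S, j ≤ ψ → ¬ ψ ≤ θ := fun ψ h1 h2 => hjnle (h1.trans h2)
  have hcard : Nat.card (Quotient θ.toSetoid) ≤ m :=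
    hres θ (Congruence.isSubdirectlyIrreducible_quotient θ j hjnle hprime)
  have : Fintype (Quotient θ.toSetoid) := Fintype.ofFinite _
  let R : Finset A := Finset.univ.image fun z : Quotient θ.toSetoid => (z.out : A)
  have hR : R.card ≤ m := Finset.card_image_le.trans (by
    rwa [Finset.card_univ, ← Nat.card_eq_fintype_card])
  -- Two pairs to be kept, one pair of the atom, and at most `m` representatives modulo `θ`: this is
  -- `m + 6`.
  let E : Finset A := {x, y, c, d, (p : A), (q : A)} ∪ R
  refine ⟨E, ?_, ?_⟩
  · have h6 : ({x, y, c, d, (p : A), (q : A)} : Finset A).card ≤ 6 := Finset.card_le_six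
    exact (Finset.card_union_le _ _).trans (by omega)
  have hES : Substructure.closure L (E : Set A) ≤ S := by
    rw [Substructure.closure_le]
    intro z hz
    simp only [E, R, Finset.coe_union, Finset.coe_insert, Finset.coe_singleton, Finset.coe_image,
      Finset.coe_univ, Set.image_univ, Set.mem_union, Set.mem_insert_iff, Set.mem_singleton_iff,
      Set.mem_range] at hz
    rcases hz with (rfl | rfl | rfl | rfl | rfl | rfl) | ⟨z, rfl⟩
    exacts [hx, hy, hc, hd, p.2, q.2, z.out.2]
  set T := Substructure.closure L (E : Set A)
  have hET : ∀ z ∈ E, z ∈ T := fun z hz => Substructure.subset_closure hz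
  have hxT : x ∈ T := hET x (by simp [E])
  have hyT : y ∈ T := hET y (by simp [E])
  have hcT : c ∈ T := hET c (by simp [E])
  have hdT : d ∈ T := hET d (by simp [E])
  have hpT : (p : A) ∈ T := hET p (by simp [E])
  have hqT : (q : A) ∈ T := hET q (by simp [E])
  have hTV : V.Mem T := V.subalgebra A T ⟨⟨x, hxT⟩⟩ hA
  refine ⟨hxT, hyT, hcT, hdT, ?_⟩
  refine Congruence.cg_inf_cg_ne_bot_of_not_rel (φ := (Substructure.inclusion hES).toHom)
    (θ := θ) (j := j) (p := ⟨p, hpT⟩) (q := ⟨q, hqT⟩) (hsd T hTV)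
    (Substructure.inclusion hES).injective ?_ hjθ hprime ?_ ?_ hpq ?_
  · intro s
    refine ⟨⟨((Quotient.mk θ.toSetoid s).out : S), hET _ (Finset.mem_union_right _
      (Finset.mem_image.2 ⟨_, Finset.mem_univ _, rfl⟩))⟩, ?_⟩
    exact θ.toSetoid.symm (Quotient.mk_out (s := θ.toSetoid) s)
  · intro hrel
    exact hsep _ (hjle.trans inf_le_left) (Congruence.cg_le_iff.2 hrel)
  · intro hrel
    exact hsep _ (hjle.trans inf_le_right) (Congruence.cg_le_iff.2 hrel)
  · intro heq
    exact hpqne (Subtype.ext (Subtype.mk.inj heq))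

end Meeting

/-! ### Small witnesses and common pairs in a subdirectly irreducible algebra. -/

section Meeting

variable {L : FirstOrder.Language.{u, v}} {A : Type w} [L.Structure A]

theorem Meets.symm {T : L.Substructure A} {x y c d : A} (h : Meets T x y c d) :
    Meets T y x c d :=
  have ⟨hx, hy, _⟩ := h
  h.of_rel le_rfl hy hx fun _ _ => Setoid.symm' _ (Congruence.cg_rel _ _)

/-- If a pair of terms that agree on all `(p, q, p)` distinguishes `x` from `y` at `(c, -, d)`, then
the principal congruences of `(x, y)` and `(c, d)` meet. -/
theorem meets_of_terms {s t : L.Term (Fin 3)}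
    (hst : ∀ p q : A, s.realize ![p, q, p] = t.realize ![p, q, p]) {x y c d : A}
    (hx : s.realize ![c, x, d] = t.realize ![c, x, d])
    (hy : s.realize ![c, y, d] ≠ t.realize ![c, y, d]) {T : L.Substructure A}
    (hxT : x ∈ T) (hyT : y ∈ T) (hcT : c ∈ T) (hdT : d ∈ T) : Meets T x y c d := by
  have hcoe : ∀ (r : L.Term (Fin 3)) (p q z : T),
      ((r.realize ![p, q, z] : T) : A) = r.realize ![(p : A), q, z] := by
    intro r p q z
    rw [← realize_term_substructure]
    congr 1
    funext i
    fin_cases i <;> rfl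
  have h3 : ∀ (θ : Congruence L T) (r : L.Term (Fin 3)) {p q z p' q' z' : T},
      θ.toSetoid p p' → θ.toSetoid q q' → θ.toSetoid z z' →
      θ.toSetoid (r.realize ![p, q, z]) (r.realize ![p', q', z']) := by
    intro θ r p q z p' q' z' h0 h1 h2
    refine θ.realize_rel r fun i => ?_
    fin_cases i
    exacts [h0, h1, h2]
  let X : T := ⟨x, hxT⟩
  let Y : T := ⟨y, hyT⟩
  let C : T := ⟨c, hcT⟩
  let D : T := ⟨d, hdT⟩
  -- The common pair is `s(c, y, d)`, `t(c, y, d)`: replacing `y` by `x` makes the two values equal,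
  -- and so does replacing `d` by `c`.
  refine ⟨hxT, hyT, hcT, hdT, Congruence.ne_bot_iff.2
    ⟨s.realize ![C, Y, D], t.realize ![C, Y, D], Congruence.inf_rel.2 ⟨?_, ?_⟩, ?_⟩⟩
  · have e : s.realize ![C, X, D] = t.realize ![C, X, D] := Subtype.ext (by rw [hcoe, hcoe]; exact hx)
    set θ := Congruence.cg (L := L) X Y
    have hXY : θ.toSetoid X Y := Congruence.cg_rel _ _
    have h1 := h3 θ s (θ.toSetoid.refl C) (θ.toSetoid.symm hXY) (θ.toSetoid.refl D)
    have h2 := h3 θ t (θ.toSetoid.refl C) hXY (θ.toSetoid.refl D)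
    exact θ.toSetoid.trans h1 (e ▸ h2)
  · have e : s.realize ![C, Y, C] = t.realize ![C, Y, C] := Subtype.ext (by rw [hcoe, hcoe, hst])
    set θ := Congruence.cg (L := L) C D
    have hCD : θ.toSetoid C D := Congruence.cg_rel _ _
    have h1 := h3 θ s (θ.toSetoid.refl C) (θ.toSetoid.refl Y) (θ.toSetoid.symm hCD)
    have h2 := h3 θ t (θ.toSetoid.refl C) (θ.toSetoid.refl Y) hCD
    exact θ.toSetoid.trans h1 (e ▸ h2)
  · intro h
    apply hy
    have := congrArg Subtype.val h
    rwa [hcoe, hcoe] at this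

variable [L.IsAlgebraic] {V : Variety.{u, v, w} L}

/-- In a subdirectly irreducible algebra all of whose `N`-generated subalgebras have small
subdirectly irreducible quotients, every principal congruence meets every principal congruence
below the monolith already in a subalgebra with few generators. -/
theorem exists_small_meets (hfin : V.IsLocallyFinite)
    (hsd : V.IsCongruenceMeetSemidistributive) (hA : V.Mem A) {m k N : ℕ}
    (hk : ∀ n, Nonempty (L.Functions n) → n ≤ k) (hN : m + 8 + k ≤ N)
    (hres : ∀ E : Finset A, E.Nonempty → E.card ≤ N →
      IsResiduallyLE m (Substructure.closure L (E : Set A)))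
    {μ : Congruence L A} (hμ : ∀ θ : Congruence L A, θ ≠ ⊥ → μ ≤ θ) {a b c d : A} (hab : a ≠ b)
    (hcd : c ≠ d) (hcdμ : μ.toSetoid c d) :
    ∃ E : Finset A, E.card ≤ m + 6 ∧ Meets (Substructure.closure L (E : Set A)) a b c d := by
  classical
  by_contra hnot
  let R : A → A → Prop := fun x y =>
    ¬ ∃ E : Finset A, E.card ≤ m + 6 ∧ Meets (Substructure.closure L (E : Set A)) x y c d
  have hRstep : ∀ {n : ℕ} (f : L.Functions n) (e : Fin n → A) (i : Fin n) (x y : A), R x y →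
      R (Structure.funMap f (Function.update e i x))
        (Structure.funMap f (Function.update e i y)) := by
    rintro n f e i x y hxy ⟨E, hE, hmeet⟩
    apply hxy
    -- Adding `x`, `y` and the parameters of `f` costs at most `2 + k`, so `E'` stays within `N`;
    -- `exists_small` then brings the witness back to `m + 6`.
    let E' : Finset A := (E ∪ {x, y}) ∪ Finset.univ.image e
    have hxE : x ∈ E' := by simp [E']
    have hyE : y ∈ E' := by simp [E']
    have hcard : E'.card ≤ N := by
      have h1 : (Finset.univ.image e).card ≤ n := Finset.card_image_le.trans (by simp)
      have h2 : ({x, y} : Finset A).card ≤ 2 := Finset.card_le_two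
      have h3 : (E ∪ {x, y}).card ≤ E.card + ({x, y} : Finset A).card := Finset.card_union_le _ _
      have h4 : E'.card ≤ (E ∪ {x, y}).card + (Finset.univ.image e).card :=
        Finset.card_union_le _ _
      have h5 := hk n ⟨f⟩
      omega
    set T := Substructure.closure L (E' : Set A)
    have hsub : ∀ z ∈ E', z ∈ T := fun z hz => Substructure.subset_closure hz
    have hle : Substructure.closure L (E : Set A) ≤ T :=
      Substructure.closure_mono (Finset.coe_subset.2 fun z hz => by simp [E', hz])
    have heT : ∀ k, e k ∈ T := fun k => hsub _ (by simp [E'])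
    have hmeet' : Meets T x y c d := by
      refine hmeet.of_rel hle (hsub x hxE) (hsub y hyE) fun hx' hy' => ?_
      have hcomp := (Congruence.cg (L := L) (⟨x, hsub x hxE⟩ : T) ⟨y, hsub y hyE⟩).compat f
        (Function.update (fun k => (⟨e k, heT k⟩ : T)) i ⟨x, hsub x hxE⟩)
        (Function.update (fun k => (⟨e k, heT k⟩ : T)) i ⟨y, hsub y hyE⟩) (fun k => by
          by_cases h : k = i
          · subst h
            simpa using Congruence.cg_rel _ _
          · simp [h])
      have hval : ∀ (z : A) (hz : z ∈ T) (hz' : Structure.funMap f (Function.update e i z) ∈ T),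
          Structure.funMap f (Function.update (fun k => (⟨e k, heT k⟩ : T)) i ⟨z, hz⟩) =
            ⟨Structure.funMap f (Function.update e i z), hz'⟩ := by
        intro z hz hz'
        apply Subtype.ext
        change Structure.funMap f _ = Structure.funMap f _
        congr 1
        funext k
        by_cases h : k = i
        · subst h; simp
        · simp [h]
      rwa [hval x _ hx', hval y _ hy'] at hcomp
    exact hmeet'.exists_small hfin hsd hA (Substructure.fg_closure (Finset.finite_toSet E'))
      (hres E' ⟨x, hxE⟩ hcard)
  let χ : Congruence L A := Congruence.ofUnary (Relation.EqvGen.setoid R) (by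
    intro n f e i x y hxy
    induction hxy with
    | rel x y h => exact .rel _ _ (hRstep f e i x y h)
    | refl x => exact .refl _
    | symm x y _ ih => exact .symm _ _ ih
    | trans x y z _ _ ih ih' => exact .trans _ _ _ ih ih')
  have hχab : χ.toSetoid a b := .rel _ _ hnot
  have hχcd : Relation.EqvGen R c d :=
    hμ χ (Congruence.ne_bot_iff.2 ⟨a, b, hχab, hab⟩) hcdμ
  obtain ⟨s, t, hst, hne⟩ := hsd.exists_terms hA hcd
  have hR : ∀ x y, R x y →
      (s.realize ![c, x, d] = t.realize ![c, x, d] ↔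
        s.realize ![c, y, d] = t.realize ![c, y, d]) := by
    intro x y hxy
    have hmem : ∀ z ∈ ({x, y, c, d} : Finset A),
        z ∈ Substructure.closure L (({x, y, c, d} : Finset A) : Set A) :=
      fun z hz => Substructure.subset_closure hz
    have hcard : ({x, y, c, d} : Finset A).card ≤ m + 6 := Finset.card_le_four.trans (by omega)
    by_contra hiff
    by_cases hx : s.realize ![c, x, d] = t.realize ![c, x, d]
    · refine hxy ⟨_, hcard, meets_of_terms hst hx (fun hy => hiff (iff_of_true hx hy)) ?_ ?_ ?_ ?_⟩
      all_goals exact hmem _ (by simp)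
    · have hy : s.realize ![c, y, d] = t.realize ![c, y, d] := by
        by_contra hy
        exact hiff (iff_of_false hx hy)
      refine hxy ⟨_, hcard, (meets_of_terms hst hy hx ?_ ?_ ?_ ?_).symm⟩
      all_goals exact hmem _ (by simp)
  have hall : ∀ x y, Relation.EqvGen R x y →
      (s.realize ![c, x, d] = t.realize ![c, x, d] ↔
        s.realize ![c, y, d] = t.realize ![c, y, d]) := by
    intro x y hxy
    induction hxy with
    | rel x y h => exact hR x y h
    | refl x => exact Iff.rfl
    | symm x y _ ih => exact ih.symm
    | trans x y z _ _ ih ih' => exact ih.trans ih'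
  exact hne (hall c d hχcd)

/-- Finitely many nontrivial principal congruences have a common nontrivial pair already in a
subalgebra with few generators. -/
theorem exists_common_pair (hfin : V.IsLocallyFinite)
    (hsd : V.IsCongruenceMeetSemidistributive) (hA : V.Mem A) {m k N : ℕ}
    (hk : ∀ n, Nonempty (L.Functions n) → n ≤ k) (hN : m + 8 + k ≤ N)
    (hres : ∀ E : Finset A, E.Nonempty → E.card ≤ N →
      IsResiduallyLE m (Substructure.closure L (E : Set A)))
    (hSI : IsSubdirectlyIrreducible L A) {ι : Type*} (P : Finset ι) (p q : ι → A)
    (hpq : ∀ i ∈ P, p i ≠ q i) :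
    ∃ E : Finset A, E.Nonempty ∧ E.card ≤ 2 + P.card * (m + 6) ∧
      ∃ u v : Substructure.closure L (E : Set A), u ≠ v ∧ ∀ i ∈ P,
        ∃ (hp : p i ∈ Substructure.closure L (E : Set A))
          (hq : q i ∈ Substructure.closure L (E : Set A)),
          (Congruence.cg (L := L) (⟨p i, hp⟩ : Substructure.closure L (E : Set A))
            ⟨q i, hq⟩).toSetoid u v := by
  classical
  obtain ⟨μ, hμ0, hμ⟩ := hSI
  -- Keeping the common pair in the monolith lets the induction continue.
  suffices h : ∃ E : Finset A, E.Nonempty ∧ E.card ≤ 2 + P.card * (m + 6) ∧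
      ∃ u v : Substructure.closure L (E : Set A), u ≠ v ∧ μ.toSetoid u v ∧ ∀ i ∈ P,
        ∃ (hp : p i ∈ Substructure.closure L (E : Set A))
          (hq : q i ∈ Substructure.closure L (E : Set A)),
          (Congruence.cg (L := L) (⟨p i, hp⟩ : Substructure.closure L (E : Set A))
            ⟨q i, hq⟩).toSetoid u v by
    obtain ⟨E, h1, h2, u, v, h3, -, h4⟩ := h
    exact ⟨E, h1, h2, u, v, h3, h4⟩
  induction P using Finset.induction_on with
  | empty =>
    obtain ⟨c, d, hcd, hne⟩ := Congruence.ne_bot_iff.1 hμ0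
    refine ⟨{c, d}, by simp, Finset.card_le_two.trans (by simp),
      ⟨c, Substructure.subset_closure (by simp)⟩, ⟨d, Substructure.subset_closure (by simp)⟩,
      fun h => hne (Subtype.mk.inj h), hcd, by simp⟩
  | insert i P hi ih =>
    obtain ⟨E, hEne, hE, c, d, hcd, hcdμ, hP⟩ := ih fun j hj => hpq j (Finset.mem_insert_of_mem hj)
    obtain ⟨E', hE', hmi, hmi', hmc, hmd, hmeet⟩ := exists_small_meets hfin hsd hA hk hN hres hμ
      (hpq i (Finset.mem_insert_self i P)) (fun h => hcd (Subtype.ext h)) hcdμ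
    obtain ⟨u, v, huv, hne⟩ := Congruence.ne_bot_iff.1 hmeet
    obtain ⟨h1, h2⟩ := Congruence.inf_rel.1 huv
    have hle : Substructure.closure L (E : Set A) ≤ Substructure.closure L ((E ∪ E' : Finset A) : Set A) :=
      Substructure.closure_mono (Finset.coe_subset.2 Finset.subset_union_left)
    have hle' : Substructure.closure L (E' : Set A) ≤ Substructure.closure L ((E ∪ E' : Finset A) : Set A) :=
      Substructure.closure_mono (Finset.coe_subset.2 Finset.subset_union_right)
    let φ := (Substructure.inclusion hle).toHom
    let φ' := (Substructure.inclusion hle').toHom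
    refine ⟨E ∪ E', hEne.mono Finset.subset_union_left, ?_, φ' u, φ' v,
      fun h => hne ((Substructure.inclusion hle').injective h), ?_, ?_⟩
    · rw [Finset.card_insert_of_notMem hi, add_mul, one_mul]
      exact (Finset.card_union_le _ _).trans (by omega)
    · exact Congruence.cg_le_iff.2 hcdμ
        (Congruence.cg_map (Substructure.closure L (E' : Set A)).subtype.toHom h2)
    · intro j hj
      rcases Finset.mem_insert.1 hj with rfl | hj
      · exact ⟨hle' hmi, hle' hmi', Congruence.cg_map φ' h1⟩
      · obtain ⟨hp, hq, hrel⟩ := hP j hj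
        exact ⟨hle hp, hle hq, Congruence.cg_le_iff.2 (Congruence.cg_map φ hrel)
          (Congruence.cg_map φ' h2)⟩

/-- A subdirectly irreducible algebra with more than `m` elements has a subalgebra with few
generators that has a subdirectly irreducible quotient with more than `m` elements. -/
theorem exists_not_isResiduallyLE (hfin : V.IsLocallyFinite)
    (hsd : V.IsCongruenceMeetSemidistributive) (hA : V.Mem A) {m k N : ℕ} (hm : 1 ≤ m)
    (hk : ∀ n, Nonempty (L.Functions n) → n ≤ k) (hN : m + 8 + k ≤ N)
    (hN' : 2 + (m ^ 2 + m) * (m + 6) ≤ N)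
    (hSI : IsSubdirectlyIrreducible L A) (hcard : (m : ℕ∞) < ENat.card A) :
    ∃ E : Finset A, E.Nonempty ∧ E.card ≤ N ∧
      ¬ IsResiduallyLE m (Substructure.closure L (E : Set A)) := by
  classical
  by_contra! hres
  obtain ⟨a⟩ : Nonempty (Fin (m + 1) ↪ A) := by
    have h1 : ((m + 1 : ℕ) : ℕ∞) ≤ (Set.univ : Set A).encard := by
      rw [Set.encard_univ]
      exact_mod_cast Order.add_one_le_of_lt hcard
    obtain ⟨s, -, hs⟩ := Set.exists_subset_encard_eq h1
    have hsf : s.Finite := Set.finite_of_encard_eq_coe hs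
    have := hsf.fintype
    refine ⟨(Fintype.equivFinOfCardEq ?_).symm.toEmbedding.trans (Function.Embedding.subtype (· ∈ s))⟩
    rw [Set.encard_eq_coe_toFinset_card] at hs
    rw [← Set.toFinset_card]
    exact_mod_cast hs
  obtain ⟨E, hEne, hE, u, v, huv, hP⟩ := exists_common_pair hfin hsd hA hk hN hres hSI
    (Finset.univ : Finset (Fin (m + 1))).offDiag (fun i => a i.1) (fun i => a i.2)
    (fun i hi h => (Finset.mem_offDiag.1 hi).2.2 (a.injective h))
  have hcardE : E.card ≤ N := by
    refine (hE.trans (le_of_eq ?_)).trans hN'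
    rw [Finset.offDiag_card, Finset.card_univ, Fintype.card_fin]
    have : (m + 1) * (m + 1) - (m + 1) = m ^ 2 + m := by
      rw [show (m + 1) * (m + 1) = (m ^ 2 + m) + (m + 1) by ring, Nat.add_sub_cancel]
    rw [this]
  have hr := hres E hEne hcardE
  set S := Substructure.closure L (E : Set A)
  have hSne : Nonempty S := ⟨u⟩
  have hSV : V.Mem S := V.subalgebra A S hSne hA
  have hSfin : Finite S :=
    Variety.finite_of_fg hfin hA (Substructure.fg_closure (Finset.finite_toSet E)) hSne
  obtain ⟨j, θ, hjle, hj, hjθ, hprime⟩ := (hsd S hSV).exists_prime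
    (Congruence.cg_ne_bot (L := L) huv)
  have hjnle : ¬ j ≤ θ := fun hle => hj (by rw [← hjθ, inf_eq_left.2 hle])
  have hq := hr θ (Congruence.isSubdirectlyIrreducible_quotient θ j hjnle hprime)
  have hmem : ∀ i, a i ∈ S := by
    intro i
    -- Membership in `S` is known only for elements occurring in some pair, so a second index is
    -- needed.
    have : Nontrivial (Fin (m + 1)) := Fin.nontrivial_iff_two_le.2 (by omega)
    obtain ⟨i', hi'⟩ := exists_ne i
    exact (hP (i, i') (Finset.mem_offDiag.2 ⟨Finset.mem_univ _, Finset.mem_univ _, hi'.symm⟩)).1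
  have hinj : Function.Injective fun i : Fin (m + 1) =>
      Quotient.mk θ.toSetoid (⟨a i, hmem i⟩ : S) := by
    intro i i' h
    by_contra hne
    obtain ⟨_, _, hrel⟩ :=
      hP (i, i') (Finset.mem_offDiag.2 ⟨Finset.mem_univ _, Finset.mem_univ _, hne⟩)
    -- If `θ` identified `a i` and `a i'`, it would contain `(u, v)` and hence `j`.
    exact hjnle (hjle.trans (Congruence.cg_le_iff.2
      (Congruence.cg_le_iff.2 (Quotient.exact h) hrel)))
  have := Nat.card_le_card_of_injective _ hinj
  rw [Nat.card_fin] at this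
  omega

end Meeting

/-- Finiteness of the language matters: `sSup` of an unbounded set of naturals is `0`. -/
theorem le_maxArity (L : FirstOrder.Language.{u, v}) [Finite L.Symbols] (n : ℕ)
    (h : Nonempty (L.Functions n)) : n ≤ maxArity L := by
  refine le_csSup (Set.Finite.bddAbove ?_) h
  have : Finite (Σ l, L.Functions l) :=
    Finite.of_injective (fun x => (Sum.inl x : L.Symbols)) Sum.inl_injective
  refine (Set.finite_range fun x : Σ l, L.Functions l => x.1).subset ?_
  rintro l ⟨f⟩
  exact ⟨⟨l, f⟩, rfl⟩

/-- The argument needs only polynomially many generators in `m`; with `t = 2 ^ m`, comparison with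
`t ^ 4` already suffices. -/
theorem generators_le {m M : ℕ} (hm : 2 ≤ m) :
    m + 8 + M ≤ 2 ^ (m ^ 2 + 7 * m) * max M 3 ∧
      2 + (m ^ 2 + m) * (m + 6) ≤ 2 ^ (m ^ 2 + 7 * m) * max M 3 := by
  have ht : m + 1 ≤ 2 ^ m := Nat.lt_two_pow_self
  have ht4 : 4 ≤ 2 ^ m := (Nat.pow_le_pow_right two_pos hm)
  have hX : (2 ^ m) ^ 4 ≤ 2 ^ (m ^ 2 + 7 * m) := by
    rw [← pow_mul]
    exact Nat.pow_le_pow_right two_pos (by nlinarith)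
  set t := 2 ^ m
  set X := 2 ^ (m ^ 2 + 7 * m)
  have h2 : 4 * t ≤ t ^ 2 := by nlinarith
  have h3 : 4 * t ^ 2 ≤ t ^ 3 := by nlinarith
  have h4 : 4 * t ^ 3 ≤ t ^ 4 := by nlinarith [Nat.zero_le (t ^ 3)]
  have hK : 3 ≤ max M 3 := le_max_right _ _
  have hM : M ≤ max M 3 := le_max_left _ _
  set K := max M 3
  constructor
  · nlinarith
  · have h5 : m ^ 2 + m ≤ t ^ 2 := by nlinarith
    have h6 : m + 6 ≤ 6 * t := by omega
    have h7 : (m ^ 2 + m) * (m + 6) ≤ t ^ 2 * (6 * t) := Nat.mul_le_mul h5 h6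
    have h8 : X * 3 ≤ X * K := Nat.mul_le_mul_left _ hK
    nlinarith

end UniversalAlgebra

theorem theorem5p1 (L : FirstOrder.Language.{u, v}) [L.IsAlgebraic] [Finite L.Symbols]
    (V : UniversalAlgebra.Variety.{u, v, w} L)
    (hfin : V.IsLocallyFinite)
    (hsd : V.IsCongruenceMeetSemidistributive)
    (m : ℕ) (hm : 2 ≤ m)
    (hex : ∃ (A : Type w) (_ : L.Structure A), V.Mem A ∧
      UniversalAlgebra.IsSubdirectlyIrreducible L A ∧ (m : ℕ∞) < ENat.card A) :
    ∃ (B : Type w) (_ : L.Structure B), V.Mem B ∧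
      UniversalAlgebra.IsSubdirectlyIrreducible L B ∧ Finite B ∧
      (m : ℕ∞) < ENat.card B ∧
      ENat.card B ≤
        V.freeSpectrum (2 ^ (m ^ 2 + 7 * m) * max (UniversalAlgebra.maxArity L) 3) := by
  obtain ⟨A, _, hA, hSI, hcard⟩ := hex
  -- The argument of the free spectrum in the goal itself serves as `N`.
  obtain ⟨hN, hN'⟩ := UniversalAlgebra.generators_le (M := UniversalAlgebra.maxArity L) hm
  obtain ⟨E, hEne, hE, hnot⟩ := UniversalAlgebra.exists_not_isResiduallyLE hfin hsd hA
    (by omega) (UniversalAlgebra.le_maxArity L) hN hN' hSI hcard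
  simp only [UniversalAlgebra.IsResiduallyLE, not_forall, not_le] at hnot
  obtain ⟨θ, hθ, hlt⟩ := hnot
  obtain ⟨a, ha⟩ := hEne
  have hne : Nonempty (FirstOrder.Language.Substructure.closure L (E : Set A)) :=
    ⟨⟨a, FirstOrder.Language.Substructure.subset_closure ha⟩⟩
  have hS := UniversalAlgebra.Variety.finite_of_fg hfin hA
    (FirstOrder.Language.Substructure.fg_closure (Finset.finite_toSet E)) hne
  refine ⟨Quotient θ.toSetoid, θ.quotientStructure,
    UniversalAlgebra.Variety.mem_quotient (V.subalgebra A _ hne hA) θ, hθ, inferInstance, ?_, ?_⟩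
  · rw [ENat.card_eq_coe_natCard]
    exact_mod_cast hlt
  · exact (ENat.card_le_card_of_injective (Function.injective_surjInv Quotient.mk_surjective)).trans
      (UniversalAlgebra.Variety.card_closure_le_freeSpectrum hA ⟨a, ha⟩ hE)
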